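/- Let $-\infty<a<b\le\infty$, let $p,q$ be complex-valued and $w$ real-valued on $[a,b)$ with $w>0$ and $p\ne0$ a.e., $w,1/p,q\in L^1_{loc}[a,b)$, and suppose that $Q=\overline{\mathrm{co}}\{q(x)/w(x)+rp(x):x\in[a,b),\,0<r<\infty\}\neq\mathbb C$, and that $b$ is singular, i.e. $b=\infty$ or $\int_a^b(w+1/|p|+|q|)\,dx=\infty$. Put $\mathcal M[y]=w^{-1}(-(py')'+qy)$ and $[u,v]=p(uv'-u'v)$. Call $(\eta,K)\in\mathbb R\times\mathbb C$ admissible if there is $\lambda_0\in\mathbb C\setminus Q$ with nearest point $K$ in $Q$ such that $\Re[(rp(x)+q(x)/w(x)-K)e^{i\eta}]\ge0$ for all $x\in[a,b)$, $r>0$, and $\Re[(\lambda_0-K)e^{i\eta}]<0$; put $\Lambda_{\eta,K}=\{\lambda:\Re[(\lambda-K)e^{i\eta}]\le0\}$. Let $\alpha\in\mathbb C$ and let $(\eta,K)$ be admissible with $\Re[e^{i\eta}\cos\alpha\,\overline{\sin\alpha}]\le0$. Suppose that $\mathcal M$ is in Sims Case II or III at $b$ with respect to $(\eta,K)$: for some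 $\lambda\in\Lambda_{\eta,K}$ all solutions of $\mathcal M[y]=\lambda y$ lie in $L^2_w[a,b)$, and either (Case II) up to constant multiples exactly one nontrivial solution, or (Case III) every solution, satisfies $$\int_a^b\Re[e^{i\eta}\{p|y'|^2+(q-Kw)|y|^2\}]\,dx+\int_a^b|y|^2w\,dx<\infty .$$ For $\lambda\in\mathbb C$ let $\theta(\cdot,\lambda),\phi(\cdot,\lambda)$ be the solutions of $\mathcal M[y]=\lambda y$ with $\phi(a,\lambda)=\sin\alpha$, $p\phi'(a,\lambda)=-\cos\alpha$, $\theta(a,\lambda)=\cos\alpha$, $p\theta'(a,\lambda)=\sin\alpha$. Fix $\lambda'\in\Lambda_{\eta,K}$ and $m(\lambda')\in\mathbb C$, and let $\psi=\theta(\cdot,\lambda')+m(\lambda')\phi(\cdot,\lambda')$. Let $M$ be the operator $My=\mathcal M[y]$ in $L^2_w[a,b)$ whose domain consists of all $y\in L^2_w[a,b)$ with $y,py'$ locally absolutely continuous on $[a,b)$, $\mathcal M[y]\in L^2_w[a,b)$, $y(a)\cos\alpha+py'(a)\sin\alpha=0$ and $[y,\psi](b)=\lim_{x\to b}[y,\psi](x)=0$.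 Let $a<b_n<b$, $b_n\nearrow b$, and let $M_n$ be the operator $M_ny=\mathcal M[y]$ in $L^2_w[a,b_n]$ whose domain consists of all $y\in L^2_w[a,b_n]$ with $y,py'$ absolutely continuous on $[a,b_n]$, $\mathcal M[y]\in L^2_w[a,b_n]$, $y(a)\cos\alpha+py'(a)\sin\alpha=0$ and $[y,\psi](b_n)=0$. Let $$m_n(\lambda)=-\frac{[\theta(\cdot,\lambda),\psi](b_n)}{[\phi(\cdot,\lambda),\psi](b_n)},\qquad \psi_n(x,\lambda)=\theta(x,\lambda)+m_n(\lambda)\phi(x,\lambda),$$ so that $[\psi_n(\cdot,\lambda),\psi](b_n)=0$, and let $$G_n(x,y,\lambda)=\begin{cases}\phi(x,\lambda)\psi_n(y,\lambda),&a<x<y<b,\\ \psi_n(x,\lambda)\phi(y,\lambda),&a<y<x<b.\end{cases}$$ Let $z\in\mathbb C$ be such that $z\notin\sigma(M)$ and $z\notin\sigma(M_n)$ for all sufficiently large $n$, and let $R(z)=(zI-M)^{-1}$. Then for all sufficiently large $n$ the formula $$(R_n(z)f)(x)=\int_a^{b_n}G_n(x,y,z)f(y)w(y)\,dy,\qquad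 f\in L^2_w[a,b),\ x\in[a,b),$$ defines a bounded operator on $L^2_w[a,b)$ which extends $(zI-M_n)^{-1}$, in the sense that $(R_n(z)f)|_{[a,b_n]}=(zI-M_n)^{-1}(f|_{[a,b_n]})$, and $\|R_n(z)-R(z)\|\to0$ in operator norm as $n\to\infty$. -/

import Mathlib

open MeasureTheory Filter Topology

noncomputable section

/-- The points of `[a, b)`, where `-∞ < a < b ≤ ∞`. -/
def leftClosedInterval (a : ℝ) (b : EReal) : Set ℝ :=
  {x : ℝ | a ≤ x ∧ (x : EReal) < b}

/-- The closed convex hull of `{q(x)/w(x) + r p(x) : x ∈ [a,b), 0 < r < ∞}`. -/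
def coefficientHull (a : ℝ) (b : EReal) (p q : ℝ → ℂ) (w : ℝ → ℝ) : Set ℂ :=
  closure (convexHull ℝ
    {ζ : ℂ | ∃ x ∈ leftClosedInterval a b, ∃ r : ℝ, 0 < r ∧ ζ = q x / (w x : ℂ) + (r : ℂ) * p x})

/-- A differential expression `M[y] = w⁻¹ (-(p y')' + q y)` on `[a, b)` with complex-valued `p, q`,
regular at `a`, singular at `b`, for which the closed convex hull above is not all of `ℂ`. -/
structure SLExpr where
  a : ℝ
  b : EReal
  p : ℝ → ℂ
  q : ℝ → ℂ
  w : ℝ → ℝ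
  a_lt_b : (a : EReal) < b
  w_pos : ∀ᵐ x, x ∈ leftClosedInterval a b → 0 < w x
  p_ne_zero : ∀ᵐ x, x ∈ leftClosedInterval a b → p x ≠ 0
  w_loc : LocallyIntegrableOn w (leftClosedInterval a b)
  inv_p_loc : LocallyIntegrableOn (fun x => (p x)⁻¹) (leftClosedInterval a b)
  q_loc : LocallyIntegrableOn q (leftClosedInterval a b)
  hull_ne_univ : coefficientHull a b p q w ≠ Set.univ
  singular : b = ⊤ ∨
    ¬ IntegrableOn (fun x => w x + 1 / ‖p x‖ + ‖q x‖) (leftClosedInterval a b)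

namespace SLExpr

/-- The interval `[a, b)`. -/
def I (E : SLExpr) : Set ℝ := leftClosedInterval E.a E.b

/-- The set `Q`. -/
def Q (E : SLExpr) : Set ℂ := coefficientHull E.a E.b E.p E.q E.w

/-- The filter of real `x` tending to `b` from the left (`atTop` if `b = ∞`). -/
def atEnd (E : SLExpr) : Filter ℝ := comap (fun x : ℝ => (x : EReal)) (𝓝[<] E.b)

/-- The measure `w dx` on `s`. -/
def wMeasure (E : SLExpr) (s : Set ℝ) : Measure ℝ :=
  (volume.restrict s).withDensity (fun x => ENNReal.ofReal (E.w x))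

/-- The weighted space `L²_w(s)`. -/
abbrev L2w (E : SLExpr) (s : Set ℝ) : Type := Lp ℂ 2 (E.wMeasure s)

/-- On the interval `s` with left endpoint `a`, `y` and `u = p y'` are locally absolutely
continuous and `-(p y')' + q y = w g` almost everywhere. Absolute continuity together with the
values of the derivatives is written in integrated form (all the integrands are integrable on
compact subintervals when `y`, `u` are continuous and `g` is continuous or lies in `L²_w(s)`). -/
def Solves (E : SLExpr) (s : Set ℝ) (g y u : ℝ → ℂ) : Prop :=
  ContinuousOn y s ∧ ContinuousOn u s ∧
    ∀ x ∈ s, y x = y E.a + ∫ t in E.a..x, u t / E.p t ∧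
      u x = u E.a + ∫ t in E.a..x, (E.q t * y t - (E.w t : ℂ) * g t)

/-- `y`, with quasi-derivative `u = p y'`, solves `M[y] = l y` on `[a, b)`. -/
def IsSolution (E : SLExpr) (l : ℂ) (y u : ℝ → ℂ) : Prop :=
  E.Solves E.I (fun x => l * y x) y u

/-- `(η, K)` is admissible: for some `l₀ ∉ Q` with nearest point `K` in `Q`, the line through `K`
with direction determined by `η` separates `l₀` from `Q`. -/
def IsAdmissible (E : SLExpr) (η : ℝ) (K : ℂ) : Prop :=
  ∃ l₀ : ℂ, l₀ ∉ E.Q ∧ K ∈ E.Q ∧ (∀ ζ ∈ E.Q, ‖l₀ - K‖ ≤ ‖l₀ - ζ‖) ∧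
    (∀ x ∈ E.I, ∀ r : ℝ, 0 < r →
      0 ≤ (((r : ℂ) * E.p x + E.q x / (E.w x : ℂ) - K) * Complex.exp (Complex.I * η)).re) ∧
    ((l₀ - K) * Complex.exp (Complex.I * η)).re < 0

/-- The set `S(α)` of admissible pairs compatible with the boundary condition at `a`. -/
def S (E : SLExpr) (α : ℂ) : Set (ℝ × ℂ) :=
  {ηK | E.IsAdmissible ηK.1 ηK.2 ∧
    (Complex.exp (Complex.I * ηK.1) * Complex.cos α * starRingEnd ℂ (Complex.sin α)).re ≤ 0}

/-- The half plane `Λ_{η,K}`. -/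
def halfPlane (η : ℝ) (K : ℂ) : Set ℂ :=
  {l : ℂ | ((l - K) * Complex.exp (Complex.I * η)).re ≤ 0}

/-- `y ∈ L²_w[a,b)` for a continuous function `y`. -/
def SqIntegrable (E : SLExpr) (y : ℝ → ℂ) : Prop :=
  IntegrableOn (fun x => ‖y x‖ ^ 2 * E.w x) E.I

/-- `∫ Re[e^{iη} (p |y'|² + (q - K w) |y|²)] dx + ∫ |y|² w dx < ∞`, where `y' = u / p`. -/
def FiniteForm (E : SLExpr) (η : ℝ) (K : ℂ) (y u : ℝ → ℂ) : Prop :=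
  IntegrableOn (fun x => (Complex.exp (Complex.I * η) *
      (E.p x * ((‖u x / E.p x‖ ^ 2 : ℝ) : ℂ) +
        (E.q x - K * (E.w x : ℂ)) * ((‖y x‖ ^ 2 : ℝ) : ℂ))).re) E.I ∧
    E.SqIntegrable y

/-- Sims Case II for `(η, K)`: up to constant multiples exactly one nontrivial solution satisfies
the finiteness condition, while all solutions lie in `L²_w[a,b)`. The classification does not depend
on `l ∈ Λ_{η,K}`; here only one such `l` is asked for. -/
def CaseII (E : SLExpr) (η : ℝ) (K : ℂ) : Prop :=
  ∃ l ∈ halfPlane η K,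
    (∃ y u : ℝ → ℂ, E.IsSolution l y u ∧ (∃ x ∈ E.I, y x ≠ 0) ∧ E.FiniteForm η K y u ∧
      ∀ y' u' : ℝ → ℂ, E.IsSolution l y' u' → E.FiniteForm η K y' u' →
        ∃ c : ℂ, ∀ x ∈ E.I, y' x = c * y x) ∧
    ∀ y u : ℝ → ℂ, E.IsSolution l y u → E.SqIntegrable y

/-- Sims Case III for `(η, K)`: all solutions lie in `L²_w[a,b)` and satisfy the finiteness
condition (for one, equivalently every, `l ∈ Λ_{η,K}`). -/
def CaseIII (E : SLExpr) (η : ℝ) (K : ℂ) : Prop :=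
  ∃ l ∈ halfPlane η K, ∀ y u : ℝ → ℂ, E.IsSolution l y u →
    E.SqIntegrable y ∧ E.FiniteForm η K y u

/-- `θ(·, l)` and `φ(·, l)`, with quasi-derivatives `θ₁ = p θ'` and `φ₁ = p φ'`, are the solutions
of `M[y] = l y` with `φ = sin α`, `p φ' = -cos α`, `θ = cos α`, `p θ' = sin α` at `a`. -/
def IsFundamentalPair (E : SLExpr) (α : ℂ) (θ θ₁ φ φ₁ : ℂ → ℝ → ℂ) : Prop :=
  ∀ l : ℂ, E.IsSolution l (θ l) (θ₁ l) ∧ E.IsSolution l (φ l) (φ₁ l) ∧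
    φ l E.a = Complex.sin α ∧ φ₁ l E.a = -Complex.cos α ∧
    θ l E.a = Complex.cos α ∧ θ₁ l E.a = Complex.sin α

/-- The Wronskian `[y, v] = p (y v' - y' v)`, with `u = p y'` and `v₁ = p v'`. -/
def wronskian (y u v v₁ : ℝ → ℂ) (x : ℝ) : ℂ := y x * v₁ x - u x * v x

/-- The boundary condition `y cos α + p y' sin α = 0` at `a`. -/
def BCa (E : SLExpr) (α : ℂ) (y u : ℝ → ℂ) : Prop :=
  y E.a * Complex.cos α + u E.a * Complex.sin α = 0

/-- The graph of the operator `M` in `L²_w[a,b)`: `M f = M[f]` for those `f` such that `f`, `p f'` are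
locally absolutely continuous, `f, M[f] ∈ L²_w[a,b)`, the boundary condition holds at `a`, and
`[f, ψ](b) = 0`; here `ψ₁ = p ψ'`. -/
def graphM (E : SLExpr) (α : ℂ) (ψ ψ₁ : ℝ → ℂ) : Set (E.L2w E.I × E.L2w E.I) :=
  {fg | ∃ y u : ℝ → ℂ, fg.1 =ᵐ[E.wMeasure E.I] y ∧ E.Solves E.I fg.2 y u ∧ E.BCa α y u ∧
    Tendsto (wronskian y u ψ ψ₁) E.atEnd (𝓝 0)}

/-- The graph of the regular operator in `L²_w[a,c]` with the same boundary condition at `a` and the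
boundary condition `[f, ψ](c) = 0`. -/
def graphTrunc (E : SLExpr) (α : ℂ) (ψ ψ₁ : ℝ → ℂ) (c : ℝ) :
    Set (E.L2w (Set.Icc E.a c) × E.L2w (Set.Icc E.a c)) :=
  {fg | ∃ y u : ℝ → ℂ, fg.1 =ᵐ[E.wMeasure (Set.Icc E.a c)] y ∧
    E.Solves (Set.Icc E.a c) fg.2 y u ∧ E.BCa α y u ∧ wronskian y u ψ ψ₁ c = 0}

/-- The Titchmarsh-Weyl function of the problem on `[a,c]`: the number `m` for which `θ + m φ`
satisfies `[θ + m φ, ψ](c) = 0`. -/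
def mTrunc (θ θ₁ φ φ₁ ψ ψ₁ : ℝ → ℂ) (c : ℝ) : ℂ :=
  -(wronskian θ θ₁ ψ ψ₁ c) / wronskian φ φ₁ ψ ψ₁ c

/-- The kernel `φ(x) ψ(t)` for `x < t` and `ψ(x) φ(t)` for `t < x`. -/
def green (φ ψ : ℝ → ℂ) (x t : ℝ) : ℂ := if x < t then φ x * ψ t else ψ x * φ t

end SLExpr

/-- `R` is the bounded, everywhere defined inverse `(z - T)⁻¹` of `z - T`, for the operator `T` with
graph `G`: `R h = f` holds exactly if `f` is in the domain of `T` and `z f - T f = h`. -/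
def IsResolventAt {H : Type*} [NormedAddCommGroup H] [NormedSpace ℂ H] (G : Set (H × H)) (z : ℂ)
    (R : H →L[ℂ] H) : Prop :=
  ∀ f h : H, R h = f ↔ (f, z • f - h) ∈ G

/-- The spectrum of the operator with graph `G`. -/
def graphSpectrum {H : Type*} [NormedAddCommGroup H] [NormedSpace ℂ H] (G : Set (H × H)) : Set ℂ :=
  {z : ℂ | ¬ ∃ R : H →L[ℂ] H, IsResolventAt G z R}

end

/-!
Two solutions of `M[y] = z y` and `M[v] = l v` satisfy `[y, v]' = (z - l) y v w`. Expanding `y` in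
a square integrable fundamental system for one value of the spectral parameter, a Grönwall
argument for the Wronskian coefficients makes all solutions square integrable for every value of
the parameter, so all Wronskians of solutions have limits at `b`. The limit `[φ, ψ](b)` is nonzero,
since otherwise `φ` would be an eigenfunction of `M` at `z ∉ σ(M)`; hence
`m_c = -[θ, ψ](c) / [φ, ψ](c)` converges to some `m` as `c → b`, and variation of constants
identifies `R(z)` with the integral operator whose kernel is the Green's function of `φ` and
`θ + m φ`. The operator truncated at `c` arises from `R(z)` by adding the rank one kernel
`(m_c - m) φ(x) φ(t)` and restricting the `t` integral to `t ≤ c`; the first change is small because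
`m_c → m`, the second because the kernel of `R(z)` is dominated by the square integrable
`A(x) A(t)` with `A = |φ| + |θ + m φ|`.
-/

section AbsolutelyContinuous

open Set

/-- `F` is absolutely continuous on the interval between `a` and `b`, with almost everywhere
derivative `f`, written in integrated form. -/
structure IsPrimitiveOn {V : Type*} [NormedAddCommGroup V] [NormedSpace ℝ V] (F f : ℝ → V)
    (a b : ℝ) : Prop where
  intervalIntegrable : IntervalIntegrable f volume a b
  eq_add_integral : ∀ x ∈ uIcc a b, F x = F a + ∫ t in a..x, f t

namespace IsPrimitiveOn

variable {V : Type*} [NormedAddCommGroup V] [NormedSpace ℝ V] {F G f g : ℝ → V} {a b : ℝ}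

-- On subintervals the increments of `∫ f` are dominated by those of the real function `∫ ‖f‖`.
theorem absolutelyContinuousOnInterval (hF : IsPrimitiveOn F f a b) :
    AbsolutelyContinuousOnInterval F a b := by
  have hnorm := hF.intervalIntegrable.norm.absolutelyContinuousOnInterval_intervalIntegral
    (c := a) left_mem_uIcc
  have dist_le : ∀ x ∈ uIcc a b, ∀ y ∈ uIcc a b,
      dist (F x) (F y) ≤ dist (∫ t in a..x, ‖f t‖) (∫ t in a..y, ‖f t‖) := by
    intro x hx y hy
    have hfx := hF.intervalIntegrable.mono_set (uIcc_subset_uIcc left_mem_uIcc hx)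
    have hfy := hF.intervalIntegrable.mono_set (uIcc_subset_uIcc left_mem_uIcc hy)
    rw [hF.eq_add_integral x hx, hF.eq_add_integral y hy, dist_add_left, dist_eq_norm,
      dist_eq_norm, intervalIntegral.integral_interval_sub_left hfx hfy,
      intervalIntegral.integral_interval_sub_left hfx.norm hfy.norm]
    exact intervalIntegral.norm_integral_le_abs_integral_norm
  rw [absolutelyContinuousOnInterval_iff] at hnorm ⊢
  intro ε hε
  obtain ⟨δ, hδ, hlt⟩ := hnorm ε hε
  refine ⟨δ, hδ, fun P hP hPδ => (Finset.sum_le_sum fun i hi => ?_).trans_lt (hlt P hP hPδ)⟩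
  exact dist_le _ (hP.1 i hi).1 _ (hP.1 i hi).2

theorem continuousOn (hF : IsPrimitiveOn F f a b) : ContinuousOn F (uIcc a b) :=
  hF.absolutelyContinuousOnInterval.continuousOn

theorem congr (hF : IsPrimitiveOn F f a b) (hFG : EqOn F G (uIcc a b))
    (hfg : EqOn f g (uIcc a b)) : IsPrimitiveOn G g a b := by
  refine ⟨hF.intervalIntegrable.congr fun x hx => hfg (uIoc_subset_uIcc hx), fun x hx => ?_⟩
  rw [← hFG hx, ← hFG left_mem_uIcc, hF.eq_add_integral x hx]
  congr 1
  exact intervalIntegral.integral_congr (hfg.mono (uIcc_subset_uIcc left_mem_uIcc hx))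

variable [CompleteSpace V]

theorem ae_hasDerivAt (hF : IsPrimitiveOn F f a b) :
    ∀ᵐ x, x ∈ uIcc a b → HasDerivAt F (f x) x := by
  filter_upwards [hF.intervalIntegrable.ae_hasDerivAt_integral,
    (volume.ae_ne (min a b)), (volume.ae_ne (max a b))] with x hderiv hmin hmax hx
  refine ((hderiv hx a left_mem_uIcc).const_add (F a)).congr_of_eventuallyEq ?_
  filter_upwards [Icc_mem_nhds (lt_of_le_of_ne hx.1 hmin.symm) (lt_of_le_of_ne hx.2 hmax)]
    with t ht using hF.eq_add_integral t ht

theorem of_ae_hasDerivAt (hF : AbsolutelyContinuousOnInterval F a b)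
    (hf : IntervalIntegrable f volume a b) (hderiv : ∀ᵐ x, x ∈ uIcc a b → HasDerivAt F (f x) x) :
    IsPrimitiveOn F f a b := by
  have hprim : IsPrimitiveOn (fun x => ∫ t in a..x, f t) f a b := ⟨hf, fun x _ => by simp⟩
  obtain ⟨C, hC⟩ := (hF.fun_sub hprim.absolutelyContinuousOnInterval).const_of_ae_hasDerivAt_zero
    (by
      filter_upwards [hderiv, hf.ae_hasDerivAt_integral] with x hFx hfx hx
      simpa only [sub_self] using (hFx hx).fun_sub (hfx hx a left_mem_uIcc))
  refine ⟨hf, fun x hx => ?_⟩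
  have hCa := hC a left_mem_uIcc
  rw [intervalIntegral.integral_same, sub_zero] at hCa
  rw [hCa, ← hC x hx, sub_add_cancel]

theorem add (hF : IsPrimitiveOn F f a b) (hG : IsPrimitiveOn G g a b) :
    IsPrimitiveOn (fun x => F x + G x) (fun x => f x + g x) a b := by
  refine of_ae_hasDerivAt
    (hF.absolutelyContinuousOnInterval.fun_add hG.absolutelyContinuousOnInterval)
    (hF.intervalIntegrable.add hG.intervalIntegrable) ?_
  filter_upwards [hF.ae_hasDerivAt, hG.ae_hasDerivAt] with x hFx hGx hx
  exact (hFx hx).fun_add (hGx hx)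

theorem sub (hF : IsPrimitiveOn F f a b) (hG : IsPrimitiveOn G g a b) :
    IsPrimitiveOn (fun x => F x - G x) (fun x => f x - g x) a b := by
  refine of_ae_hasDerivAt
    (hF.absolutelyContinuousOnInterval.fun_sub hG.absolutelyContinuousOnInterval)
    (hF.intervalIntegrable.sub hG.intervalIntegrable) ?_
  filter_upwards [hF.ae_hasDerivAt, hG.ae_hasDerivAt] with x hFx hGx hx
  exact (hFx hx).fun_sub (hGx hx)

section NormedField

variable {𝕜 : Type*} [NormedField 𝕜] [NormedAlgebra ℝ 𝕜] [CompleteSpace 𝕜] {F G f g : ℝ → 𝕜}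

theorem mul (hF : IsPrimitiveOn F f a b) (hG : IsPrimitiveOn G g a b) :
    IsPrimitiveOn (fun x => F x * G x) (fun x => f x * G x + F x * g x) a b := by
  refine of_ae_hasDerivAt
    (hF.absolutelyContinuousOnInterval.fun_smul hG.absolutelyContinuousOnInterval)
    ((hF.intervalIntegrable.mul_continuousOn hG.continuousOn).add
      (hG.intervalIntegrable.continuousOn_mul hF.continuousOn)) ?_
  filter_upwards [hF.ae_hasDerivAt, hG.ae_hasDerivAt] with x hFx hGx hx
  exact (hFx hx).fun_mul (hGx hx)

theorem const_mul (c : 𝕜) (hF : IsPrimitiveOn F f a b) :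
    IsPrimitiveOn (fun x => c * F x) (fun x => c * f x) a b := by
  refine of_ae_hasDerivAt (hF.absolutelyContinuousOnInterval.const_smul c)
    (hF.intervalIntegrable.const_mul c) ?_
  filter_upwards [hF.ae_hasDerivAt] with x hFx hx using (hFx hx).const_mul c

end NormedField

end IsPrimitiveOn

end AbsolutelyContinuous

namespace SLExpr

open Set

variable (E : SLExpr)

theorem a_mem_I : E.a ∈ E.I := ⟨le_rfl, E.a_lt_b⟩

theorem ordConnected_I : E.I.OrdConnected :=
  ⟨fun _ hx _ hy _ hz => ⟨hx.1.trans hz.1, lt_of_le_of_lt (EReal.coe_le_coe_iff.2 hz.2) hy.2⟩⟩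

theorem measurableSet_I : MeasurableSet E.I := E.ordConnected_I.measurableSet

variable {E} {x : ℝ} {s : Set ℝ}

section Interval

theorem Icc_subset_I (hx : x ∈ E.I) : Icc E.a x ⊆ E.I :=
  E.ordConnected_I.out E.a_mem_I hx

theorem uIcc_subset_I (hx : x ∈ E.I) : uIcc E.a x ⊆ E.I :=
  E.ordConnected_I.uIcc_subset E.a_mem_I hx

theorem exists_mem_I_gt (hx : x ∈ E.I) : ∃ c ∈ E.I, x < c := by
  obtain ⟨c, hxc, hcb⟩ := EReal.lt_iff_exists_real_btwn.1 hx.2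
  have hxc' := EReal.coe_lt_coe_iff.1 hxc
  exact ⟨c, ⟨hx.1.trans hxc'.le, hcb⟩, hxc'⟩

theorem continuousOn_I_of_forall_uIcc {X : Type*} [TopologicalSpace X] {F : ℝ → X}
    (hF : ∀ c ∈ E.I, ContinuousOn F (uIcc E.a c)) : ContinuousOn F E.I := by
  intro x hx
  obtain ⟨c, hc, hxc⟩ := exists_mem_I_gt hx
  refine (hF c hc x (Icc_subset_uIcc ⟨hx.1, hxc.le⟩)).mono_of_mem_nhdsWithin ?_
  filter_upwards [self_mem_nhdsWithin, mem_nhdsWithin_of_mem_nhds (Iio_mem_nhds hxc)]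
    with t htI htc using Icc_subset_uIcc ⟨htI.1, le_of_lt htc⟩

instance : E.atEnd.IsCountablyGenerated := by unfold atEnd; infer_instance

theorem eventually_lt_atEnd {t : ℝ} (ht : (t : EReal) < E.b) :
    ∀ᶠ x in E.atEnd, t < x ∧ (x : EReal) < E.b := by
  filter_upwards [preimage_mem_comap (Ioo_mem_nhdsLT ht)] with x hx
  exact ⟨EReal.coe_lt_coe_iff.1 hx.1, hx.2⟩

theorem eventually_mem_I : ∀ᶠ x in E.atEnd, x ∈ E.I := by
  filter_upwards [eventually_lt_atEnd E.a_lt_b] with x hx using ⟨hx.1.le, hx.2⟩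

instance : E.atEnd.NeBot := by
  refine comap_neBot fun t ht => ?_
  obtain ⟨l, hl, hlt⟩ := (mem_nhdsLT_iff_exists_Ioo_subset' E.a_lt_b).1 ht
  obtain ⟨x, hlx, hxb⟩ := EReal.lt_iff_exists_real_btwn.1 hl
  exact ⟨x, hlt ⟨hlx, hxb⟩⟩

end Interval

section Coefficients

theorem intervalIntegrable_of_locallyIntegrableOn {V : Type*} [NormedAddCommGroup V] {f : ℝ → V}
    (hf : LocallyIntegrableOn f E.I) (hx : x ∈ E.I) : IntervalIntegrable f volume E.a x :=
  (hf.integrableOn_compact_subset (uIcc_subset_I hx) isCompact_uIcc).intervalIntegrable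

theorem intervalIntegrable_div_p {u : ℝ → ℂ} (hx : x ∈ E.I) (hu : ContinuousOn u E.I) :
    IntervalIntegrable (fun t => u t / E.p t) volume E.a x := by
  simp only [div_eq_mul_inv]
  exact (intervalIntegrable_of_locallyIntegrableOn E.inv_p_loc hx).continuousOn_mul
    (hu.mono (uIcc_subset_I hx))

theorem aemeasurable_w (hs : s ⊆ E.I) : AEMeasurable E.w (volume.restrict s) :=
  E.w_loc.aestronglyMeasurable.aemeasurable.mono_set hs

theorem ae_w_pos (hm : MeasurableSet s) (hs : s ⊆ E.I) : ∀ᵐ x ∂volume.restrict s, 0 < E.w x := by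
  rw [ae_restrict_iff' hm]
  filter_upwards [E.w_pos] with x hx hxs using hx (hs hxs)

end Coefficients

section WeightedMeasure

theorem ae_wMeasure (hm : MeasurableSet s) (hs : s ⊆ E.I) :
    ae (E.wMeasure s) = ae (volume.restrict s) := by
  refine le_antisymm (withDensity_absolutelyContinuous _ _).ae_le
    (withDensity_absolutelyContinuous' (aemeasurable_w hs).ennreal_ofReal ?_).ae_le
  filter_upwards [ae_w_pos hm hs] with x hx using ENNReal.ofReal_ne_zero_iff.2 hx

theorem ae_mem_I : ∀ᵐ x ∂E.wMeasure E.I, x ∈ E.I := by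
  rw [ae_wMeasure E.measurableSet_I subset_rfl]
  exact ae_restrict_mem E.measurableSet_I

theorem wMeasure_restrict_Iic (hx : x ∈ E.I) :
    (E.wMeasure E.I).restrict (Iic x) = E.wMeasure (Icc E.a x) := by
  have inter_eq : Iic x ∩ E.I = Icc E.a x :=
    Subset.antisymm (fun _ ht => ⟨ht.2.1, ht.1⟩) fun _ ht => ⟨ht.2, Icc_subset_I hx ht⟩
  rw [wMeasure, restrict_withDensity measurableSet_Iic,
    Measure.restrict_restrict measurableSet_Iic, inter_eq, wMeasure]

theorem aestronglyMeasurable_of_continuousOn {V : Type*} [TopologicalSpace V]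
    [TopologicalSpace.PseudoMetrizableSpace V] {y : ℝ → V} (hy : ContinuousOn y E.I) :
    AEStronglyMeasurable y (E.wMeasure E.I) :=
  (hy.aestronglyMeasurable E.measurableSet_I).mono_ac (withDensity_absolutelyContinuous _ _)

variable {V : Type*} [NormedAddCommGroup V] [NormedSpace ℝ V] {g : ℝ → V}

theorem integrable_wMeasure_iff (hm : MeasurableSet s) (hs : s ⊆ E.I) :
    Integrable g (E.wMeasure s) ↔ IntegrableOn (fun x => E.w x • g x) s := by
  rw [wMeasure, integrable_withDensity_iff_integrable_smul₀'
    (aemeasurable_w hs).ennreal_ofReal (.of_forall fun _ => ENNReal.ofReal_lt_top), IntegrableOn]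
  refine integrable_congr ?_
  filter_upwards [ae_w_pos hm hs] with x hx
  rw [ENNReal.toReal_ofReal hx.le]

theorem integral_wMeasure (hm : MeasurableSet s) (hs : s ⊆ E.I) (g : ℝ → V) :
    ∫ x, g x ∂E.wMeasure s = ∫ x in s, E.w x • g x := by
  rw [wMeasure, integral_withDensity_eq_integral_toReal_smul₀
    (aemeasurable_w hs).ennreal_ofReal (.of_forall fun _ => ENNReal.ofReal_lt_top)]
  refine integral_congr_ae ?_
  filter_upwards [ae_w_pos hm hs] with x hx
  rw [ENNReal.toReal_ofReal hx.le]

theorem integrableOn_Iic_iff (hx : x ∈ E.I) :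
    IntegrableOn g (Iic x) (E.wMeasure E.I) ↔
      IntervalIntegrable (fun t => E.w t • g t) volume E.a x := by
  rw [IntegrableOn, wMeasure_restrict_Iic hx,
    integrable_wMeasure_iff measurableSet_Icc (Icc_subset_I hx),
    intervalIntegrable_iff_integrableOn_Icc_of_le hx.1]

theorem setIntegral_Iic (hx : x ∈ E.I) (g : ℝ → V) :
    ∫ t in Iic x, g t ∂E.wMeasure E.I = ∫ t in E.a..x, E.w t • g t := by
  rw [wMeasure_restrict_Iic hx, integral_wMeasure measurableSet_Icc (Icc_subset_I hx),
    intervalIntegral.integral_of_le hx.1, integral_Icc_eq_integral_Ioc]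

theorem setIntegral_Iic_a (g : ℝ → V) : ∫ t in Iic E.a, g t ∂E.wMeasure E.I = 0 := by
  rw [setIntegral_Iic E.a_mem_I, intervalIntegral.integral_same]

theorem integrableOn_Iic_of_continuousOn (hx : x ∈ E.I) (hg : ContinuousOn g E.I) :
    IntegrableOn g (Iic x) (E.wMeasure E.I) :=
  (integrableOn_Iic_iff hx).2 <|
    (intervalIntegrable_of_locallyIntegrableOn E.w_loc hx).smul_continuousOn
      (hg.mono (uIcc_subset_I hx))

theorem isPrimitiveOn_setIntegral_Iic (hx : x ∈ E.I)
    (hg : IntegrableOn g (Iic x) (E.wMeasure E.I)) :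
    IsPrimitiveOn (fun t => ∫ s in Iic t, g s ∂E.wMeasure E.I) (fun t => E.w t • g t) E.a x where
  intervalIntegrable := (integrableOn_Iic_iff hx).1 hg
  eq_add_integral t ht := by
    rw [setIntegral_Iic_a, zero_add, setIntegral_Iic (uIcc_subset_I hx ht)]

theorem isPrimitiveOn_setIntegral_Ioi (hx : x ∈ E.I) (hg : Integrable g (E.wMeasure E.I)) :
    IsPrimitiveOn (fun t => ∫ s in Ioi t, g s ∂E.wMeasure E.I) (fun t => -(E.w t • g t))
      E.a x where
  intervalIntegrable := ((integrableOn_Iic_iff hx).1 hg.integrableOn).neg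
  eq_add_integral t ht := by
    have split : ∀ s, ∫ r in Iic s, g r ∂E.wMeasure E.I + ∫ r in Ioi s, g r ∂E.wMeasure E.I =
        ∫ r, g r ∂E.wMeasure E.I := fun s =>
      intervalIntegral.integral_Iic_add_Ioi hg.integrableOn hg.integrableOn
    have hIoi := (split t).trans (split E.a).symm
    rw [setIntegral_Iic_a, zero_add] at hIoi
    rw [intervalIntegral.integral_neg, ← setIntegral_Iic (uIcc_subset_I hx ht), ← hIoi]
    abel

theorem aecover_Iic : AECover (E.wMeasure E.I) E.atEnd Iic where
  ae_eventually_mem := by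
    filter_upwards [ae_mem_I] with t ht
    filter_upwards [eventually_lt_atEnd ht.2] with x hx using hx.1.le
  measurableSet _ := measurableSet_Iic

theorem tendsto_setIntegral_Ioi (hg : Integrable g (E.wMeasure E.I)) :
    Tendsto (fun x => ∫ t in Ioi x, g t ∂E.wMeasure E.I) E.atEnd (𝓝 0) := by
  have h := (aecover_Iic.integral_tendsto_of_countably_generated hg).const_sub
    (∫ t, g t ∂E.wMeasure E.I)
  rw [sub_self] at h
  refine h.congr fun x => ?_
  rw [← intervalIntegral.integral_Iic_add_Ioi hg.integrableOn hg.integrableOn,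
    add_sub_cancel_left]

theorem SqIntegrable.memLp {y : ℝ → ℂ} (hy : ContinuousOn y E.I) (h : E.SqIntegrable y) :
    MemLp y 2 (E.wMeasure E.I) := by
  rw [memLp_two_iff_integrable_sq_norm (aestronglyMeasurable_of_continuousOn hy),
    integrable_wMeasure_iff E.measurableSet_I subset_rfl]
  simpa only [SqIntegrable, smul_eq_mul, mul_comm] using h

end WeightedMeasure

end SLExpr

namespace SLExpr

open Set

variable {E : SLExpr} {x : ℝ} {s : Set ℝ} {g k y u v v₁ : ℝ → ℂ} {l z : ℂ}

namespace Solves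

theorem mono {t : Set ℝ} (h : E.Solves s g y u) (hts : t ⊆ s) : E.Solves t g y u :=
  ⟨h.1.mono hts, h.2.1.mono hts, fun x hx => h.2.2 x (hts hx)⟩

theorem congr (h : E.Solves s g y u) (hs : s.OrdConnected) (ha : E.a ∈ s)
    (hgk : g =ᵐ[volume.restrict s] k) : E.Solves s k y u := by
  refine ⟨h.1, h.2.1, fun x hx => ⟨(h.2.2 x hx).1, (h.2.2 x hx).2.trans ?_⟩⟩
  congr 1
  refine intervalIntegral.integral_congr_ae ?_
  rw [EventuallyEq, ae_restrict_iff' hs.measurableSet] at hgk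
  filter_upwards [hgk] with t ht htx
  rw [ht (hs.uIcc_subset ha hx (uIoc_subset_uIcc htx))]

theorem isPrimitiveOn_fst (h : E.Solves E.I g y u) (hx : x ∈ E.I) :
    IsPrimitiveOn y (fun t => u t / E.p t) E.a x where
  intervalIntegrable := intervalIntegrable_div_p hx h.2.1
  eq_add_integral t ht := (h.2.2 t (uIcc_subset_I hx ht)).1

theorem isPrimitiveOn_snd (h : E.Solves E.I g y u) (hx : x ∈ E.I)
    (hg : IntegrableOn g (Iic x) (E.wMeasure E.I)) :
    IsPrimitiveOn u (fun t => E.q t * y t - (E.w t : ℂ) * g t) E.a x where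
  intervalIntegrable := ((intervalIntegrable_of_locallyIntegrableOn E.q_loc hx).mul_continuousOn
    (h.1.mono (uIcc_subset_I hx))).sub
      (by simpa only [Complex.real_smul] using (integrableOn_Iic_iff hx).1 hg)
  eq_add_integral t ht := (h.2.2 t (uIcc_subset_I hx ht)).2

theorem of_isPrimitiveOn (hy : ∀ x ∈ E.I, IsPrimitiveOn y (fun t => u t / E.p t) E.a x)
    (hu : ∀ x ∈ E.I, IsPrimitiveOn u (fun t => E.q t * y t - (E.w t : ℂ) * g t) E.a x) :
    E.Solves E.I g y u :=
  ⟨continuousOn_I_of_forall_uIcc fun x hx => (hy x hx).continuousOn,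
    continuousOn_I_of_forall_uIcc fun x hx => (hu x hx).continuousOn, fun x hx =>
    ⟨(hy x hx).eq_add_integral x right_mem_uIcc, (hu x hx).eq_add_integral x right_mem_uIcc⟩⟩

theorem continuousOn_wronskian (h : E.Solves E.I g y u) (h' : E.Solves E.I k v v₁) :
    ContinuousOn (wronskian y u v v₁) E.I :=
  (h.1.mul h'.2.1).sub (h.2.1.mul h'.1)

theorem wronskian_eq_add_setIntegral (h : E.Solves E.I g y u) (h' : E.Solves E.I k v v₁)
    (hx : x ∈ E.I) (hg : IntegrableOn g (Iic x) (E.wMeasure E.I))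
    (hk : IntegrableOn k (Iic x) (E.wMeasure E.I)) :
    wronskian y u v v₁ x = wronskian y u v v₁ E.a +
      ∫ t in Iic x, (g t * v t - y t * k t) ∂E.wMeasure E.I := by
  have hprim := ((h.isPrimitiveOn_fst hx).mul (h'.isPrimitiveOn_snd hx hk)).sub
    ((h.isPrimitiveOn_snd hx hg).mul (h'.isPrimitiveOn_fst hx))
  rw [setIntegral_Iic hx]
  refine (hprim.eq_add_integral x right_mem_uIcc).trans (congrArg _ ?_)
  refine intervalIntegral.integral_congr fun t _ => ?_
  simp only [Complex.real_smul]
  ring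

end Solves

namespace IsSolution

theorem integrableOn_mul (hy : E.IsSolution z y u) (hv : E.IsSolution l v v₁) (hx : x ∈ E.I) :
    IntegrableOn (fun t => y t * v t) (Iic x) (E.wMeasure E.I) :=
  integrableOn_Iic_of_continuousOn hx (hy.1.mul hv.1)

theorem integrableOn_rhs (hy : E.IsSolution z y u) (hx : x ∈ E.I) :
    IntegrableOn (fun t => z * y t) (Iic x) (E.wMeasure E.I) :=
  integrableOn_Iic_of_continuousOn hx (hy.1.const_mul z)

theorem wronskian_eq (hy : E.IsSolution z y u) (hv : E.IsSolution l v v₁) (hx : x ∈ E.I) :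
    wronskian y u v v₁ x = wronskian y u v v₁ E.a +
      (z - l) * ∫ t in Iic x, y t * v t ∂E.wMeasure E.I := by
  rw [Solves.wronskian_eq_add_setIntegral hy hv hx (hy.integrableOn_rhs hx)
    (hv.integrableOn_rhs hx), ← integral_const_mul]
  congr 2 with t
  ring

theorem wronskian_const (hy : E.IsSolution z y u) (hv : E.IsSolution z v v₁) (hx : x ∈ E.I) :
    wronskian y u v v₁ x = wronskian y u v v₁ E.a := by
  rw [hy.wronskian_eq hv hx, sub_self, zero_mul, add_zero]

theorem norm_wronskian_le {c : ℝ} (hy : E.IsSolution z y u) (hv : E.IsSolution l v v₁)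
    (hc : c ∈ E.I) (hx : x ∈ E.I) (hcx : c ≤ x) :
    ‖wronskian y u v v₁ x‖ ≤ ‖wronskian y u v v₁ c‖ +
      ‖z - l‖ * ∫ t in Ioc c x, ‖y t‖ * ‖v t‖ ∂E.wMeasure E.I := by
  have increment : wronskian y u v v₁ x = wronskian y u v v₁ c +
      (z - l) * ∫ t in Ioc c x, y t * v t ∂E.wMeasure E.I := by
    rw [← intervalIntegral.integral_of_le hcx, ← intervalIntegral.integral_Iic_sub_Iic
      (hy.integrableOn_mul hv hc) (hy.integrableOn_mul hv hx), hy.wronskian_eq hv hx,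
      hy.wronskian_eq hv hc]
    ring
  rw [increment]
  refine (norm_add_le _ _).trans ?_
  rw [norm_mul]
  gcongr
  simpa only [norm_mul] using norm_integral_le_integral_norm (fun t => y t * v t)

theorem add_const_mul (hy : E.IsSolution z y u) (hv : E.IsSolution z v v₁) (c : ℂ) :
    E.IsSolution z (fun x => y x + c * v x) (fun x => u x + c * v₁ x) := by
  refine Solves.of_isPrimitiveOn (fun x hx => ?_) fun x hx => ?_
  · refine ((Solves.isPrimitiveOn_fst hy hx).add
      ((Solves.isPrimitiveOn_fst hv hx).const_mul c)).congr (eqOn_refl _ _) fun t _ => ?_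
    ring
  · refine ((Solves.isPrimitiveOn_snd hy hx (hy.integrableOn_rhs hx)).add
      ((Solves.isPrimitiveOn_snd hv hx (hv.integrableOn_rhs hx)).const_mul c)).congr
        (eqOn_refl _ _) fun t _ => ?_
    ring

end IsSolution

/-- A fundamental system `φ, χ` of solutions of `M[y] = z y` with Wronskian `1`, both of whose
members are square integrable. -/
structure IsL2FundamentalSystem (E : SLExpr) (z : ℂ) (φ φ₁ χ χ₁ : ℝ → ℂ) : Prop where
  left : E.IsSolution z φ φ₁
  right : E.IsSolution z χ χ₁
  wronskian_a : wronskian φ φ₁ χ χ₁ E.a = 1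
  memLp_left : MemLp φ 2 (E.wMeasure E.I)
  memLp_right : MemLp χ 2 (E.wMeasure E.I)

/-- The limit circle condition at `b`: for some spectral parameter every solution is square
integrable. -/
def IsLimitCircle (E : SLExpr) : Prop :=
  ∃ l : ℂ, ∀ y u, E.IsSolution l y u → E.SqIntegrable y

section SquareIntegrability

theorem gronwall_le_two_mul {μ : Measure ℝ} {B k : ℝ → ℝ} {c X C : ℝ} (hcX : c ≤ X)
    (hB : ContinuousOn B (Icc c X)) (hB_nonneg : ∀ t ∈ Icc c X, 0 ≤ B t)
    (hk : IntegrableOn k (Ioc c X) μ) (hk_nonneg : ∀ t, 0 ≤ k t)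
    (hk_le : ∫ t in Ioc c X, k t ∂μ ≤ 1 / 2)
    (hle : ∀ x ∈ Icc c X, B x ≤ C + ∫ t in Ioc c x, k t * B t ∂μ) : B X ≤ 2 * C := by
  obtain ⟨x, hx, hmax⟩ := isCompact_Icc.exists_isMaxOn (nonempty_Icc.2 hcX) hB
  have hsub : Ioc c x ⊆ Ioc c X := Ioc_subset_Ioc_right hx.2
  have integral_le : ∫ t in Ioc c x, k t * B t ∂μ ≤ 1 / 2 * B x := by
    calc ∫ t in Ioc c x, k t * B t ∂μ ≤ ∫ t in Ioc c x, k t * B x ∂μ := by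
          refine setIntegral_mono_on ?_ ((hk.mono_set hsub).mul_const _) measurableSet_Ioc
            fun t ht => ?_
          · exact (hk.mul_continuousOn_of_subset hB measurableSet_Ioc isCompact_Icc
              Ioc_subset_Icc_self).mono_set hsub
          · exact mul_le_mul_of_nonneg_left (hmax (Ioc_subset_Icc_self (hsub ht))) (hk_nonneg t)
      _ = (∫ t in Ioc c x, k t ∂μ) * B x := integral_mul_const _ _
      _ ≤ (∫ t in Ioc c X, k t ∂μ) * B x := by
          refine mul_le_mul_of_nonneg_right ?_ (hB_nonneg x hx)
          exact setIntegral_mono_set hk (.of_forall hk_nonneg) hsub.eventuallyLE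
      _ ≤ 1 / 2 * B x := mul_le_mul_of_nonneg_right hk_le (hB_nonneg x hx)
  have hX : B X ≤ B x := hmax (right_mem_Icc.2 hcX)
  linarith [hle x hx]

namespace IsL2FundamentalSystem

variable {φ φ₁ χ χ₁ : ℝ → ℂ}

theorem wronskian_eq_one (hS : E.IsL2FundamentalSystem l φ φ₁ χ χ₁) (hx : x ∈ E.I) :
    wronskian φ φ₁ χ χ₁ x = 1 := by
  rw [hS.left.wronskian_const hS.right hx, hS.wronskian_a]

theorem memLp_norm_add_norm (hS : E.IsL2FundamentalSystem l φ φ₁ χ χ₁) :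
    MemLp (fun t => ‖φ t‖ + ‖χ t‖) 2 (E.wMeasure E.I) :=
  hS.memLp_left.norm.add hS.memLp_right.norm

theorem norm_le_mul_wronskian (hS : E.IsL2FundamentalSystem l φ φ₁ χ χ₁) (hx : x ∈ E.I)
    (y u : ℝ → ℂ) : ‖y x‖ ≤ (‖φ x‖ + ‖χ x‖) *
      (‖wronskian y u φ φ₁ x‖ + ‖wronskian y u χ χ₁ x‖) := by
  have expansion : y x = φ x * wronskian y u χ χ₁ x - χ x * wronskian y u φ φ₁ x := by
    calc y x = y x * wronskian φ φ₁ χ χ₁ x := by rw [hS.wronskian_eq_one hx, mul_one]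
      _ = _ := by simp only [wronskian]; ring
  calc ‖y x‖ ≤ ‖φ x‖ * ‖wronskian y u χ χ₁ x‖ + ‖χ x‖ * ‖wronskian y u φ φ₁ x‖ := by
        rw [expansion, ← norm_mul, ← norm_mul]
        exact norm_sub_le _ _
    _ ≤ (‖φ x‖ + ‖χ x‖) * ‖wronskian y u χ χ₁ x‖ +
        (‖φ x‖ + ‖χ x‖) * ‖wronskian y u φ φ₁ x‖ := by gcongr <;> simp
    _ = _ := by ring

theorem wronskian_le_add_setIntegral {c : ℝ} (hS : E.IsL2FundamentalSystem l φ φ₁ χ χ₁)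
    (hy : E.IsSolution z y u) (hc : c ∈ E.I) (hx : x ∈ E.I) (hcx : c ≤ x) :
    ‖wronskian y u φ φ₁ x‖ + ‖wronskian y u χ χ₁ x‖ ≤
      ‖wronskian y u φ φ₁ c‖ + ‖wronskian y u χ χ₁ c‖ +
        ∫ t in Ioc c x, ‖z - l‖ * (‖φ t‖ + ‖χ t‖) ^ 2 *
          (‖wronskian y u φ φ₁ t‖ + ‖wronskian y u χ χ₁ t‖) ∂E.wMeasure E.I := by
  have norm_integrableOn : ∀ v v₁, E.IsSolution l v v₁ →
      IntegrableOn (fun t => ‖y t‖ * ‖v t‖) (Ioc c x) (E.wMeasure E.I) := fun v v₁ hv =>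
    (integrableOn_Iic_of_continuousOn hx (hy.1.norm.mul hv.1.norm)).mono_set Ioc_subset_Iic_self
  have integral_le : ‖z - l‖ * ((∫ t in Ioc c x, ‖y t‖ * ‖φ t‖ ∂E.wMeasure E.I) +
      ∫ t in Ioc c x, ‖y t‖ * ‖χ t‖ ∂E.wMeasure E.I) ≤
      ∫ t in Ioc c x, ‖z - l‖ * (‖φ t‖ + ‖χ t‖) ^ 2 *
        (‖wronskian y u φ φ₁ t‖ + ‖wronskian y u χ χ₁ t‖) ∂E.wMeasure E.I := by
    have hint := (norm_integrableOn φ φ₁ hS.left).add (norm_integrableOn χ χ₁ hS.right)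
    rw [← integral_add (norm_integrableOn φ φ₁ hS.left) (norm_integrableOn χ χ₁ hS.right),
      ← integral_const_mul]
    refine setIntegral_mono_on (hint.const_mul _) ?_ measurableSet_Ioc fun t ht => ?_
    · refine (integrableOn_Iic_of_continuousOn hx ?_).mono_set Ioc_subset_Iic_self
      exact (continuousOn_const.mul ((hS.left.1.norm.add hS.right.1.norm).pow 2)).mul
        ((Solves.continuousOn_wronskian hy hS.left).norm.add
          (Solves.continuousOn_wronskian hy hS.right).norm)
    · have htI : t ∈ E.I := E.ordConnected_I.out hc hx (Ioc_subset_Icc_self ht)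
      calc ‖z - l‖ * (‖y t‖ * ‖φ t‖ + ‖y t‖ * ‖χ t‖)
          = ‖z - l‖ * (‖φ t‖ + ‖χ t‖) * ‖y t‖ := by ring
        _ ≤ ‖z - l‖ * (‖φ t‖ + ‖χ t‖) * ((‖φ t‖ + ‖χ t‖) *
            (‖wronskian y u φ φ₁ t‖ + ‖wronskian y u χ χ₁ t‖)) := by
          gcongr
          exact hS.norm_le_mul_wronskian htI y u
        _ = _ := by ring
  linarith [hy.norm_wronskian_le hS.left hc hx hcx, hy.norm_wronskian_le hS.right hc hx hcx]

theorem exists_wronskian_bound (hS : E.IsL2FundamentalSystem l φ φ₁ χ χ₁)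
    (hy : E.IsSolution z y u) :
    ∃ C, ∀ x ∈ E.I, ‖wronskian y u φ φ₁ x‖ + ‖wronskian y u χ χ₁ x‖ ≤ C := by
  set B : ℝ → ℝ := fun t => ‖wronskian y u φ φ₁ t‖ + ‖wronskian y u χ χ₁ t‖
  set k : ℝ → ℝ := fun t => ‖z - l‖ * (‖φ t‖ + ‖χ t‖) ^ 2
  have hk : Integrable k (E.wMeasure E.I) := hS.memLp_norm_add_norm.integrable_sq.const_mul _
  have k_nonneg : ∀ t, 0 ≤ k t := fun t => by positivity
  have hB : ContinuousOn B E.I := (Solves.continuousOn_wronskian hy hS.left).norm.add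
    (Solves.continuousOn_wronskian hy hS.right).norm
  obtain ⟨c, hc, hk_le⟩ : ∃ c ∈ E.I, ∫ t in Ioi c, k t ∂E.wMeasure E.I ≤ 1 / 2 :=
    (eventually_mem_I.and ((tendsto_setIntegral_Ioi hk).eventually_le_const one_half_pos)).exists
  obtain ⟨C, hC⟩ := isCompact_Icc.exists_bound_of_continuousOn (hB.mono (Icc_subset_I hc))
  refine ⟨max C (2 * B c), fun x hx => ?_⟩
  rcases le_total x c with hxc | hcx
  · exact ((le_abs_self _).trans (hC x ⟨hx.1, hxc⟩)).trans (le_max_left _ _)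
  · have hsub : Icc c x ⊆ E.I := E.ordConnected_I.out hc hx
    refine (gronwall_le_two_mul hcx (hB.mono hsub) (fun t _ => by positivity)
      hk.integrableOn k_nonneg (le_trans ?_ hk_le) fun t ht => ?_).trans (le_max_right _ _)
    · exact setIntegral_mono_set hk.integrableOn (.of_forall k_nonneg)
        Ioc_subset_Ioi_self.eventuallyLE
    · exact hS.wronskian_le_add_setIntegral hy hc (hsub ht) ht.1

theorem memLp_of_isSolution (hS : E.IsL2FundamentalSystem l φ φ₁ χ χ₁)
    (hy : E.IsSolution z y u) : MemLp y 2 (E.wMeasure E.I) := by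
  obtain ⟨C, hC⟩ := hS.exists_wronskian_bound hy
  refine (hS.memLp_norm_add_norm.mul_const C).mono' (aestronglyMeasurable_of_continuousOn hy.1) ?_
  filter_upwards [ae_mem_I] with t ht
  exact (hS.norm_le_mul_wronskian ht y u).trans
    (mul_le_mul_of_nonneg_left (hC t ht) (by positivity))

theorem add_const_mul (hS : E.IsL2FundamentalSystem z φ φ₁ χ χ₁) (κ : ℂ) :
    E.IsL2FundamentalSystem z φ φ₁ (fun x => χ x + κ * φ x) (fun x => χ₁ x + κ * φ₁ x) where
  left := hS.left
  right := hS.right.add_const_mul hS.left κ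
  wronskian_a := by
    rw [← hS.wronskian_a, wronskian, wronskian]
    ring
  memLp_left := hS.memLp_left
  memLp_right := hS.memLp_right.add (hS.memLp_left.const_mul κ)

end IsL2FundamentalSystem

theorem IsFundamentalPair.wronskian_a {α : ℂ} {θ θ₁ φ φ₁ : ℂ → ℝ → ℂ}
    (h : E.IsFundamentalPair α θ θ₁ φ φ₁) (z : ℂ) :
    wronskian (φ z) (φ₁ z) (θ z) (θ₁ z) E.a = 1 := by
  obtain ⟨-, -, hφ, hφ₁, hθ, hθ₁⟩ := h z
  rw [wronskian, hφ, hφ₁, hθ, hθ₁, ← Complex.sin_sq_add_cos_sq α]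
  ring

theorem IsFundamentalPair.isL2FundamentalSystem {α : ℂ} {θ θ₁ φ φ₁ : ℂ → ℝ → ℂ}
    (h : E.IsFundamentalPair α θ θ₁ φ φ₁) (hE : E.IsLimitCircle) (z : ℂ) :
    E.IsL2FundamentalSystem z (φ z) (φ₁ z) (θ z) (θ₁ z) := by
  obtain ⟨l, hl⟩ := hE
  obtain ⟨hθ, hφ, -⟩ := h l
  have hS : E.IsL2FundamentalSystem l (φ l) (φ₁ l) (θ l) (θ₁ l) :=
    ⟨hφ, hθ, h.wronskian_a l, (hl _ _ hφ).memLp hφ.1, (hl _ _ hθ).memLp hθ.1⟩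
  exact ⟨(h z).2.1, (h z).1, h.wronskian_a z, hS.memLp_of_isSolution (h z).2.1,
    hS.memLp_of_isSolution (h z).1⟩

end SquareIntegrability

end SLExpr

section SquareIntegrable

variable {X 𝕜 V W : Type*} {p : ENNReal} [Fact (1 ≤ p)] [MeasurableSpace X] {μ : Measure X}
  [NontriviallyNormedField 𝕜] [NormedAddCommGroup V] [NormedSpace 𝕜 V] [NormedAddCommGroup W]
  [NormedSpace 𝕜 W] {s : Set X}

variable (𝕜 V p μ) in
/-- Multiplication by the indicator function of a measurable set, as an operator on `Lᵖ`. -/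
noncomputable def indicatorCLM (hs : MeasurableSet s) : Lp V p μ →L[𝕜] Lp V p μ :=
  (ContinuousLinearMap.lsmul 𝕜 𝕜).holderL μ ⊤ p p
    (((memLp_top_const (1 : 𝕜)).indicator hs).toLp (s.indicator fun _ => 1))

theorem coeFn_indicatorCLM (hs : MeasurableSet s) (f : Lp V p μ) :
    indicatorCLM 𝕜 V p μ hs f =ᵐ[μ] s.indicator f := by
  refine (ContinuousLinearMap.coeFn_holder (r := p) (ContinuousLinearMap.lsmul 𝕜 𝕜)
    (((memLp_top_const (1 : 𝕜)).indicator hs).toLp (s.indicator fun _ => 1)) f).trans ?_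
  filter_upwards [((memLp_top_const (μ := μ) (1 : 𝕜)).indicator hs).coeFn_toLp] with x hx
  rw [hx, ContinuousLinearMap.lsmul_apply]
  by_cases h : x ∈ s <;> simp [h]

theorem norm_indicatorCLM_le (hs : MeasurableSet s) : ‖indicatorCLM 𝕜 V p μ hs‖ ≤ 1 := by
  refine ContinuousLinearMap.opNorm_le_bound _ zero_le_one fun f =>
    Lp.norm_le_mul_norm_of_ae_le_mul ?_
  filter_upwards [coeFn_indicatorCLM (𝕜 := 𝕜) hs f] with x hx
  rw [hx, one_mul]
  exact norm_indicator_le_norm_self _ _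

theorem indicatorCLM_add_compl (hs : MeasurableSet s) (f : Lp V p μ) :
    indicatorCLM 𝕜 V p μ hs f + indicatorCLM 𝕜 V p μ hs.compl f = f := by
  refine Lp.ext ?_
  filter_upwards [Lp.coeFn_add (indicatorCLM 𝕜 V p μ hs f) (indicatorCLM 𝕜 V p μ hs.compl f),
    coeFn_indicatorCLM (𝕜 := 𝕜) hs f, coeFn_indicatorCLM (𝕜 := 𝕜) hs.compl f]
    with x hadd hx hx_compl
  rw [hadd, Pi.add_apply, hx, hx_compl, Set.indicator_self_add_compl_apply]

theorem norm_add_comp_indicatorCLM_sub_le (R S : Lp V p μ →L[𝕜] Lp V p μ)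
    (hs : MeasurableSet s) : ‖(R + S) ∘L indicatorCLM 𝕜 V p μ hs - R‖ ≤
      ‖S‖ + ‖R ∘L indicatorCLM 𝕜 V p μ hs.compl‖ := by
  have decomposition : (R + S) ∘L indicatorCLM 𝕜 V p μ hs - R =
      S ∘L indicatorCLM 𝕜 V p μ hs - R ∘L indicatorCLM 𝕜 V p μ hs.compl := by
    ext1 f
    have hf := congrArg R (indicatorCLM_add_compl (𝕜 := 𝕜) hs f)
    rw [map_add] at hf
    simp only [sub_apply, ContinuousLinearMap.comp_apply, add_apply, ← hf]
    abel
  rw [decomposition]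
  refine (norm_sub_le _ _).trans (add_le_add_left ?_ _)
  exact (S.opNorm_comp_le _).trans
    (mul_le_of_le_one_right (norm_nonneg S) (norm_indicatorCLM_le hs))

theorem integral_mul_norm_indicatorCLM_le {A : X → ℝ} (hA : MemLp A 2 μ) (hs : MeasurableSet s)
    (f : Lp V 2 μ) :
    ∫ x, A x * ‖indicatorCLM 𝕜 V 2 μ hs f x‖ ∂μ ≤ √(∫ x in s, A x ^ 2 ∂μ) * ‖f‖ := by
  have hint := ((Lp.memLp f).restrict s).norm
  have norm_f : ‖f‖ = √(∫ x, ‖f x‖ ^ 2 ∂μ) := by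
    rw [Lp.norm_def, (Lp.memLp f).eLpNorm_eq_integral_rpow_norm two_ne_zero ENNReal.ofNat_ne_top,
      ENNReal.toReal_ofReal (by positivity), Real.sqrt_eq_rpow]
    simp
  calc ∫ x, A x * ‖indicatorCLM 𝕜 V 2 μ hs f x‖ ∂μ = ∫ x in s, A x * ‖f x‖ ∂μ := by
        rw [← integral_indicator hs]
        refine integral_congr_ae ?_
        filter_upwards [coeFn_indicatorCLM (𝕜 := 𝕜) hs f] with x hx
        rw [hx]
        by_cases h : x ∈ s <;> simp [h]
    _ ≤ ∫ x in s, ‖A x‖ * ‖‖f x‖‖ ∂μ := by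
        refine integral_mono ((hA.restrict s).integrable_mul hint)
          ((hA.restrict s).norm.integrable_mul hint.norm) fun x => ?_
        simpa using mul_le_mul_of_nonneg_right (le_abs_self (A x)) (norm_nonneg (f x))
    _ ≤ √(∫ x in s, A x ^ 2 ∂μ) * √(∫ x in s, ‖f x‖ ^ 2 ∂μ) := by
        have h := integral_mul_norm_le_Lp_mul_Lq Real.HolderConjugate.two_two
          (by simpa using hA.restrict s) (by simpa using hint)
        simpa only [Real.sqrt_eq_rpow, Real.rpow_ofNat, Real.norm_eq_abs, sq_abs] using h
    _ ≤ √(∫ x in s, A x ^ 2 ∂μ) * ‖f‖ := by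
        rw [norm_f]
        gcongr
        · exact .of_forall fun x => sq_nonneg _
        · exact (Lp.memLp f).norm.integrable_sq
        · exact Measure.restrict_le_self

theorem norm_comp_indicatorCLM_le {T : Lp V 2 μ →L[𝕜] Lp W 2 μ} {A : X → ℝ} (hA : MemLp A 2 μ)
    (hA_nonneg : 0 ≤ A)
    (hT : ∀ f, ∀ᵐ x ∂μ, ‖T f x‖ ≤ A x * ∫ t, A t * ‖f t‖ ∂μ) (hs : MeasurableSet s) :
    ‖T ∘L indicatorCLM 𝕜 V 2 μ hs‖ ≤ ‖hA.toLp A‖ * √(∫ x in s, A x ^ 2 ∂μ) := by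
  refine ContinuousLinearMap.opNorm_le_bound _ (by positivity) fun f => ?_
  rw [mul_assoc, mul_comm, ContinuousLinearMap.comp_apply]
  refine Lp.norm_le_mul_norm_of_ae_le_mul ?_
  filter_upwards [hT (indicatorCLM 𝕜 V 2 μ hs f), hA.coeFn_toLp] with x hx hAx
  rw [hAx, Real.norm_of_nonneg (hA_nonneg x), mul_comm]
  exact hx.trans (mul_le_mul_of_nonneg_left (integral_mul_norm_indicatorCLM_le hA hs f)
    (hA_nonneg x))

/-- The rank one operator `f ↦ (∫ φ f dμ) v`. -/
noncomputable def rankOneCLM {𝕜 : Type*} [RCLike 𝕜] {q : ENNReal} [Fact (1 ≤ q)]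
    [q.HolderConjugate p] {φ v : X → 𝕜} (hφ : MemLp φ q μ) (hv : MemLp v p μ) :
    Lp 𝕜 p μ →L[𝕜] Lp 𝕜 p μ :=
  ((ContinuousLinearMap.mul 𝕜 𝕜).lpPairing μ q p (hφ.toLp φ)).smulRight (hv.toLp v)

theorem coeFn_rankOneCLM {𝕜 : Type*} [RCLike 𝕜] {q : ENNReal} [Fact (1 ≤ q)]
    [q.HolderConjugate p] {φ v : X → 𝕜} (hφ : MemLp φ q μ) (hv : MemLp v p μ) (f : Lp 𝕜 p μ) :
    rankOneCLM hφ hv f =ᵐ[μ] fun x => (∫ t, φ t * f t ∂μ) * v x := by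
  have pairing_eq : (ContinuousLinearMap.mul 𝕜 𝕜).lpPairing μ q p (hφ.toLp φ) f =
      ∫ t, φ t * f t ∂μ := by
    rw [ContinuousLinearMap.lpPairing_eq_integral]
    refine integral_congr_ae ?_
    filter_upwards [hφ.coeFn_toLp] with t ht
    rw [ht, ContinuousLinearMap.mul_apply']
  rw [rankOneCLM, ContinuousLinearMap.smulRight_apply, pairing_eq]
  filter_upwards [Lp.coeFn_smul (∫ t, φ t * f t ∂μ) (hv.toLp v), hv.coeFn_toLp] with x hsmul hx
  rw [hsmul, Pi.smul_apply, hx, smul_eq_mul]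

end SquareIntegrable

namespace SLExpr

open Set

variable {E : SLExpr} {α l z : ℂ} {y u v v₁ f φ φ₁ χ χ₁ : ℝ → ℂ}

section GreenSolution

/-- The integral `∫_a^x v f w`. -/
noncomputable def lowerCoeff (E : SLExpr) (v f : ℝ → ℂ) (x : ℝ) : ℂ :=
  ∫ t in Iic x, v t * f t ∂E.wMeasure E.I

/-- The integral `∫_x^b v f w`. -/
noncomputable def upperCoeff (E : SLExpr) (v f : ℝ → ℂ) (x : ℝ) : ℂ :=
  ∫ t in Ioi x, v t * f t ∂E.wMeasure E.I

/-- The function `φ ∫_x^b χ f w + χ ∫_a^x φ f w`, which solves `(z - M) y = f` by variation of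
constants if `φ`, `χ` solve `M[y] = z y` and have Wronskian `1`. -/
noncomputable def greenSolution (E : SLExpr) (φ χ f : ℝ → ℂ) (x : ℝ) : ℂ :=
  φ x * E.upperCoeff χ f x + χ x * E.lowerCoeff φ f x

/-- The quasi-derivative `p y'` of `y = greenSolution E φ χ f`, where `φ₁ = p φ'`, `χ₁ = p χ'`. -/
noncomputable def greenSolutionDeriv (E : SLExpr) (φ φ₁ χ χ₁ f : ℝ → ℂ) (x : ℝ) : ℂ :=
  φ₁ x * E.upperCoeff χ f x + χ₁ x * E.lowerCoeff φ f x

theorem BCa.greenSolution (h : E.BCa α φ φ₁) :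
    E.BCa α (E.greenSolution φ χ f) (E.greenSolutionDeriv φ φ₁ χ χ₁ f) := by
  have lowerCoeff_a : E.lowerCoeff φ f E.a = 0 := setIntegral_Iic_a _
  simp only [BCa, SLExpr.greenSolution, greenSolutionDeriv, lowerCoeff_a] at h ⊢
  linear_combination E.upperCoeff χ f E.a * h

theorem wronskian_greenSolution (φ φ₁ χ χ₁ f ψ ψ₁ : ℝ → ℂ) (x : ℝ) :
    wronskian (E.greenSolution φ χ f) (E.greenSolutionDeriv φ φ₁ χ χ₁ f) ψ ψ₁ x =
      E.upperCoeff χ f x * wronskian φ φ₁ ψ ψ₁ x +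
        E.lowerCoeff φ f x * wronskian χ χ₁ ψ ψ₁ x := by
  simp only [wronskian, greenSolution, greenSolutionDeriv]
  ring

theorem greenSolution_eq_integral_green (hφ : Integrable (fun t => φ t * f t) (E.wMeasure E.I))
    (hχ : Integrable (fun t => χ t * f t) (E.wMeasure E.I)) (x : ℝ) :
    E.greenSolution φ χ f x = ∫ t, green φ χ x t * f t ∂E.wMeasure E.I := by
  have eqOn_Iic : EqOn (fun t => green φ χ x t * f t) (fun t => χ x * (φ t * f t)) (Iic x) := by
    intro t ht
    simp only [green, if_neg (not_lt.2 (mem_Iic.1 ht)), mul_assoc]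
  have eqOn_Ioi : EqOn (fun t => green φ χ x t * f t) (fun t => φ x * (χ t * f t)) (Ioi x) := by
    intro t ht
    simp only [green, if_pos (mem_Ioi.1 ht), mul_assoc]
  rw [← intervalIntegral.integral_Iic_add_Ioi (b := x)
      ((integrableOn_congr_fun eqOn_Iic measurableSet_Iic).2 (hφ.const_mul _).integrableOn)
      ((integrableOn_congr_fun eqOn_Ioi measurableSet_Ioi).2 (hχ.const_mul _).integrableOn),
    setIntegral_congr_fun measurableSet_Iic eqOn_Iic,
    setIntegral_congr_fun measurableSet_Ioi eqOn_Ioi, integral_const_mul, integral_const_mul,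
    add_comm]
  rfl

theorem greenSolution_add_const_mul (hφ : Integrable (fun t => φ t * f t) (E.wMeasure E.I))
    (hχ : Integrable (fun t => χ t * f t) (E.wMeasure E.I)) (κ : ℂ) (x : ℝ) :
    E.greenSolution φ (fun t => χ t + κ * φ t) f x =
      E.greenSolution φ χ f x + κ * (∫ t, φ t * f t ∂E.wMeasure E.I) * φ x := by
  have upper_add : E.upperCoeff (fun t => χ t + κ * φ t) f x =
      E.upperCoeff χ f x + κ * E.upperCoeff φ f x := by
    rw [upperCoeff, upperCoeff, upperCoeff, ← integral_const_mul,
      ← integral_add hχ.restrict (hφ.const_mul κ).restrict]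
    congr 1 with t
    ring
  rw [greenSolution, greenSolution, upper_add,
    ← intervalIntegral.integral_Iic_add_Ioi (b := x) hφ.integrableOn hφ.integrableOn]
  simp only [lowerCoeff, upperCoeff]
  ring

namespace IsL2FundamentalSystem

variable (hS : E.IsL2FundamentalSystem z φ φ₁ χ χ₁) (hf : MemLp f 2 (E.wMeasure E.I))

include hS hf

theorem solves_greenSolution :
    E.Solves E.I (fun t => z * E.greenSolution φ χ f t - f t)
      (E.greenSolution φ χ f) (E.greenSolutionDeriv φ φ₁ χ χ₁ f) := by
  have hL : ∀ x ∈ E.I, IsPrimitiveOn (E.lowerCoeff φ f) _ E.a x := fun x hx =>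
    isPrimitiveOn_setIntegral_Iic hx (hS.memLp_left.integrable_mul hf).integrableOn
  have hU : ∀ x ∈ E.I, IsPrimitiveOn (E.upperCoeff χ f) _ E.a x := fun x hx =>
    isPrimitiveOn_setIntegral_Ioi hx (hS.memLp_right.integrable_mul hf)
  refine Solves.of_isPrimitiveOn (fun x hx => ?_) fun x hx => ?_
  · refine (((Solves.isPrimitiveOn_fst hS.left hx).mul (hU x hx)).add
      ((Solves.isPrimitiveOn_fst hS.right hx).mul (hL x hx))).congr (eqOn_refl _ _) fun t _ => ?_
    simp only [greenSolutionDeriv, Complex.real_smul]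
    ring
  · refine (((Solves.isPrimitiveOn_snd hS.left hx (hS.left.integrableOn_rhs hx)).mul
      (hU x hx)).add ((Solves.isPrimitiveOn_snd hS.right hx (hS.right.integrableOn_rhs hx)).mul
        (hL x hx))).congr (eqOn_refl _ _) fun t ht => ?_
    have hW := hS.wronskian_eq_one (uIcc_subset_I hx ht)
    simp only [wronskian] at hW
    simp only [greenSolution, Complex.real_smul]
    linear_combination (E.w t * f t) * hW

theorem norm_greenSolution_le (x : ℝ) : ‖E.greenSolution φ χ f x‖ ≤
    (‖φ x‖ + ‖χ x‖) * ∫ t, (‖φ t‖ + ‖χ t‖) * ‖f t‖ ∂E.wMeasure E.I := by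
  have setIntegral_le : ∀ (v : ℝ → ℂ) (s : Set ℝ), (∀ t, ‖v t‖ ≤ ‖φ t‖ + ‖χ t‖) →
      ‖∫ t in s, v t * f t ∂E.wMeasure E.I‖ ≤
        ∫ t, (‖φ t‖ + ‖χ t‖) * ‖f t‖ ∂E.wMeasure E.I := by
    intro v s hv
    have hint := hS.memLp_norm_add_norm.integrable_mul hf.norm
    refine (norm_integral_le_of_norm_le (hint.integrableOn (s := s)) (.of_forall fun t => ?_)).trans
      (setIntegral_le_integral hint (.of_forall fun t => ?_))
    · rw [norm_mul]
      exact mul_le_mul_of_nonneg_right (hv t) (norm_nonneg _)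
    · simp only [Pi.mul_apply, Pi.zero_apply]
      positivity
  calc ‖E.greenSolution φ χ f x‖
      ≤ ‖φ x‖ * ‖E.upperCoeff χ f x‖ + ‖χ x‖ * ‖E.lowerCoeff φ f x‖ := by
        rw [← norm_mul, ← norm_mul]
        exact norm_add_le _ _
    _ ≤ _ := by
        rw [add_mul]
        gcongr
        · exact setIntegral_le χ _ fun t => by simp
        · exact setIntegral_le φ _ fun t => by simp

theorem memLp_greenSolution : MemLp (E.greenSolution φ χ f) 2 (E.wMeasure E.I) :=
  (hS.memLp_norm_add_norm.mul_const _).mono'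
    (aestronglyMeasurable_of_continuousOn (hS.solves_greenSolution hf).1)
    (.of_forall fun x => hS.norm_greenSolution_le hf x)

end IsL2FundamentalSystem

end GreenSolution

namespace IsSolution

theorem exists_tendsto_wronskian (hy : E.IsSolution z y u) (hv : E.IsSolution l v v₁)
    (hyL : MemLp y 2 (E.wMeasure E.I)) (hvL : MemLp v 2 (E.wMeasure E.I)) :
    ∃ ω : ℂ, Tendsto (wronskian y u v v₁) E.atEnd (𝓝 ω) := by
  refine ⟨_, (((aecover_Iic.integral_tendsto_of_countably_generated
    (hyL.integrable_mul hvL)).const_mul (z - l)).const_add (wronskian y u v v₁ E.a)).congr' ?_⟩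
  filter_upwards [eventually_mem_I] with x hx using (hy.wronskian_eq hv hx).symm

theorem initial_eq_zero_of_ae_eq_zero (hy : E.IsSolution z y u) (h0 : y =ᵐ[E.wMeasure E.I] 0) :
    y E.a = 0 ∧ u E.a = 0 := by
  obtain ⟨c, hc, hac⟩ := exists_mem_I_gt E.a_mem_I
  have hsub := Icc_subset_I hc
  have ha : E.a ∈ Icc E.a c := left_mem_Icc.2 hac.le
  have hy0 : EqOn y 0 (Icc E.a c) := by
    rw [EventuallyEq, ae_wMeasure E.measurableSet_I subset_rfl] at h0
    exact Measure.eqOn_Icc_of_ae_eq volume hac.ne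
      (ae_restrict_of_ae_restrict_of_subset hsub h0) (hy.1.mono hsub) continuousOn_const
  have hu0 : EqOn u 0 (Icc E.a c) := by
    refine Measure.eqOn_Icc_of_ae_eq volume hac.ne ?_ (hy.2.1.mono hsub) continuousOn_const
    rw [← restrict_Ioo_eq_restrict_Icc, EventuallyEq, ae_restrict_iff' measurableSet_Ioo]
    filter_upwards [(Solves.isPrimitiveOn_fst hy hc).ae_hasDerivAt, E.p_ne_zero]
      with x hderiv hp hx
    have hxc := Ioo_subset_Icc_self hx
    have hderiv0 : HasDerivAt y 0 x := (hasDerivAt_const x (0 : ℂ)).congr_of_eventuallyEq <|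
      eventually_of_mem (Icc_mem_nhds hx.1 hx.2) hy0
    exact (div_eq_zero_iff.1 ((hderiv (Icc_subset_uIcc hxc)).unique hderiv0)).resolve_right
      (hp (hsub hxc))
  exact ⟨hy0 ha, hu0 ha⟩

end IsSolution

end SLExpr

namespace SLExpr

open Set

variable {E : SLExpr} {c : ℝ} {s : Set ℝ} {α l z ω : ℂ}
  {y u f φ φ₁ χ χ₁ θ θ₁ ψ ψ₁ : ℝ → ℂ}

section WeylFunction

theorem wronskian_add_const_mul (κ : ℂ) (y u v v₁ ψ ψ₁ : ℝ → ℂ) (x : ℝ) :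
    wronskian (fun t => y t + κ * v t) (fun t => u t + κ * v₁ t) ψ ψ₁ x =
      wronskian y u ψ ψ₁ x + κ * wronskian v v₁ ψ ψ₁ x := by
  simp only [wronskian]
  ring

theorem wronskian_add_mTrunc_mul (h : wronskian φ φ₁ ψ ψ₁ c ≠ 0) :
    wronskian (fun t => θ t + mTrunc θ θ₁ φ φ₁ ψ ψ₁ c * φ t)
      (fun t => θ₁ t + mTrunc θ θ₁ φ φ₁ ψ ψ₁ c * φ₁ t) ψ ψ₁ c = 0 := by
  rw [wronskian_add_const_mul, mTrunc, div_mul_cancel₀ _ h, add_neg_cancel]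

end WeylFunction

section Truncation

variable (E c) in
/-- The operator in `L²_w[a,b)` that replaces a function by zero on `(c, b)`. -/
noncomputable def truncation : E.L2w E.I →L[ℂ] E.L2w E.I :=
  indicatorCLM ℂ ℂ 2 (E.wMeasure E.I) (measurableSet_Iic (a := c))

theorem coeFn_truncation (F : E.L2w E.I) :
    E.truncation c F =ᵐ[E.wMeasure E.I] (Iic c).indicator F :=
  coeFn_indicatorCLM _ F

theorem truncation_ae_eq (hc : c ∈ E.I) (F : E.L2w E.I) :
    E.truncation c F =ᵐ[E.wMeasure (Icc E.a c)] F := by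
  rw [← wMeasure_restrict_Iic hc]
  filter_upwards [ae_restrict_of_ae (coeFn_truncation F), ae_restrict_mem measurableSet_Iic]
    with t ht htc
  rw [ht, indicator_of_mem htc]

theorem upperCoeff_truncation (v : ℝ → ℂ) (c : ℝ) (F : E.L2w E.I) :
    E.upperCoeff v (E.truncation c F) c = 0 := by
  refine setIntegral_eq_zero_of_ae_eq_zero ?_
  filter_upwards [coeFn_truncation F] with t ht htc
  rw [ht, indicator_of_notMem (notMem_Iic.2 htc), mul_zero]

theorem integral_mul_truncation (hc : c ∈ E.I) (k : ℝ → ℂ) (F : E.L2w E.I) :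
    ∫ t, k t * E.truncation c F t ∂E.wMeasure E.I = ∫ t in E.a..c, k t * F t * (E.w t : ℂ) := by
  have ae_eq : (fun t => k t * E.truncation c F t) =ᵐ[E.wMeasure E.I]
      (Iic c).indicator fun t => k t * F t := by
    filter_upwards [coeFn_truncation F] with t ht
    rw [ht, indicator_mul_right]
  rw [integral_congr_ae ae_eq, integral_indicator measurableSet_Iic, setIntegral_Iic hc]
  simp only [Complex.real_smul, mul_comm]

end Truncation

section Resolvent

theorem Solves.sub_toLp (h : E.Solves s (fun t => z * y t - f t) y u) (hs : s.OrdConnected)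
    (ha : E.a ∈ s) (hsI : s ⊆ E.I) (hy : MemLp y 2 (E.wMeasure s)) {F : E.L2w s}
    (hF : F =ᵐ[E.wMeasure s] f) : E.Solves s (z • hy.toLp y - F : E.L2w s) y u := by
  refine h.congr hs ha ?_
  rw [EventuallyEq, ← ae_wMeasure hs.measurableSet hsI]
  filter_upwards [Lp.coeFn_sub (z • hy.toLp y) F, Lp.coeFn_smul z (hy.toLp y), hy.coeFn_toLp, hF]
    with t hsub hsmul hyt hFt
  rw [hsub, Pi.sub_apply, hsmul, Pi.smul_apply, hyt, hFt, smul_eq_mul]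

namespace IsL2FundamentalSystem

theorem not_tendsto_wronskian_zero (hS : E.IsL2FundamentalSystem z φ φ₁ θ θ₁)
    (hbc : E.BCa α φ φ₁) {R : E.L2w E.I →L[ℂ] E.L2w E.I}
    (hR : IsResolventAt (E.graphM α ψ ψ₁) z R) :
    ¬ Tendsto (wronskian φ φ₁ ψ ψ₁) E.atEnd (𝓝 0) := by
  intro hend
  have hφ := hS.memLp_left
  have hsolves : E.Solves E.I (fun t => z * φ t - (0 : ℝ → ℂ) t) φ φ₁ := by
    simp only [Pi.zero_apply, sub_zero]
    exact hS.left
  have eigenvector : (hφ.toLp φ, z • hφ.toLp φ - 0) ∈ E.graphM α ψ ψ₁ :=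
    ⟨φ, φ₁, hφ.coeFn_toLp, hsolves.sub_toLp E.ordConnected_I E.a_mem_I subset_rfl hφ
      (Lp.coeFn_zero _ _ _), hbc, hend⟩
  have toLp_eq_zero : hφ.toLp φ = 0 := by rw [← (hR _ _).2 eigenvector, map_zero]
  obtain ⟨ha, ha₁⟩ :=
    hS.left.initial_eq_zero_of_ae_eq_zero ((MemLp.toLp_eq_toLp_iff hφ .zero).1 toLp_eq_zero)
  have hW := hS.wronskian_a
  rw [wronskian, ha, ha₁, zero_mul, zero_mul, sub_zero] at hW
  exact zero_ne_one hW

theorem exists_tendsto_mTrunc (hS : E.IsL2FundamentalSystem z φ φ₁ θ θ₁) (hbc : E.BCa α φ φ₁)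
    (hψ : E.IsSolution l ψ ψ₁) {R : E.L2w E.I →L[ℂ] E.L2w E.I}
    (hR : IsResolventAt (E.graphM α ψ ψ₁) z R) :
    ∃ ω m, ω ≠ 0 ∧ Tendsto (wronskian φ φ₁ ψ ψ₁) E.atEnd (𝓝 ω) ∧
      Tendsto (mTrunc θ θ₁ φ φ₁ ψ ψ₁) E.atEnd (𝓝 m) ∧
      Tendsto (wronskian (fun t => θ t + m * φ t) (fun t => θ₁ t + m * φ₁ t) ψ ψ₁)
        E.atEnd (𝓝 0) := by
  have hψL := hS.memLp_of_isSolution hψ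
  obtain ⟨ω, hω⟩ := hS.left.exists_tendsto_wronskian hψ hS.memLp_left hψL
  obtain ⟨τ, hτ⟩ := hS.right.exists_tendsto_wronskian hψ hS.memLp_right hψL
  have hω0 : ω ≠ 0 := fun h => hS.not_tendsto_wronskian_zero hbc hR (h ▸ hω)
  refine ⟨ω, -τ / ω, hω0, hω, hτ.neg.div hω hω0, ?_⟩
  have h := hτ.add (hω.const_mul (-τ / ω))
  rw [div_mul_cancel₀ _ hω0, add_neg_cancel] at h
  exact h.congr fun x => (wronskian_add_const_mul _ _ _ _ _ _ _ x).symm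

theorem resolvent_ae_eq_greenSolution (hS : E.IsL2FundamentalSystem z φ φ₁ χ χ₁)
    (hbc : E.BCa α φ φ₁) {R : E.L2w E.I →L[ℂ] E.L2w E.I}
    (hR : IsResolventAt (E.graphM α ψ ψ₁) z R)
    (hφ : Tendsto (wronskian φ φ₁ ψ ψ₁) E.atEnd (𝓝 ω))
    (hχ : Tendsto (wronskian χ χ₁ ψ ψ₁) E.atEnd (𝓝 0)) (F : E.L2w E.I) :
    R F =ᵐ[E.wMeasure E.I] E.greenSolution φ χ F := by
  have hF := Lp.memLp F
  have hY := hS.memLp_greenSolution hF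
  have bc_b : Tendsto (wronskian (E.greenSolution φ χ F) (E.greenSolutionDeriv φ φ₁ χ χ₁ F) ψ ψ₁)
      E.atEnd (𝓝 0) := by
    have h := ((tendsto_setIntegral_Ioi (hS.memLp_right.integrable_mul hF)).mul hφ).add
      ((aecover_Iic.integral_tendsto_of_countably_generated
        (hS.memLp_left.integrable_mul hF)).mul hχ)
    rw [zero_mul, mul_zero, add_zero] at h
    exact h.congr fun x => (wronskian_greenSolution _ _ _ _ _ _ _ x).symm
  have hmem : (hY.toLp _, z • hY.toLp _ - F) ∈ E.graphM α ψ ψ₁ :=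
    ⟨_, _, hY.coeFn_toLp, (hS.solves_greenSolution hF).sub_toLp E.ordConnected_I E.a_mem_I
      subset_rfl hY .rfl, hbc.greenSolution, bc_b⟩
  rw [(hR _ _).2 hmem]
  exact hY.coeFn_toLp

theorem truncatedResolvent_ae_eq_greenSolution (hS : E.IsL2FundamentalSystem z φ φ₁ χ χ₁)
    (hbc : E.BCa α φ φ₁) (hc : c ∈ E.I) {Rc : E.L2w (Icc E.a c) →L[ℂ] E.L2w (Icc E.a c)}
    (hRc : IsResolventAt (E.graphTrunc α ψ ψ₁ c) z Rc) (hχ : wronskian χ χ₁ ψ ψ₁ c = 0)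
    {F : E.L2w E.I} {G : E.L2w (Icc E.a c)} (hGF : G =ᵐ[E.wMeasure (Icc E.a c)] F) :
    Rc G =ᵐ[E.wMeasure (Icc E.a c)] E.greenSolution φ χ (E.truncation c F) := by
  have hF := Lp.memLp (E.truncation c F)
  have hY : MemLp (E.greenSolution φ χ (E.truncation c F)) 2 (E.wMeasure (Icc E.a c)) := by
    rw [← wMeasure_restrict_Iic hc]
    exact (hS.memLp_greenSolution hF).restrict _
  have bc_c : wronskian (E.greenSolution φ χ (E.truncation c F))
      (E.greenSolutionDeriv φ φ₁ χ χ₁ (E.truncation c F)) ψ ψ₁ c = 0 := by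
    rw [wronskian_greenSolution, upperCoeff_truncation, hχ, zero_mul, mul_zero, add_zero]
  have hmem : (hY.toLp _, z • hY.toLp _ - G) ∈ E.graphTrunc α ψ ψ₁ c :=
    ⟨_, _, hY.coeFn_toLp, ((hS.solves_greenSolution hF).mono (Icc_subset_I hc)).sub_toLp
      ordConnected_Icc (left_mem_Icc.2 hc.1) (Icc_subset_I hc) hY
      (hGF.trans (truncation_ae_eq hc F).symm), hbc.greenSolution, bc_c⟩
  rw [(hRc _ _).2 hmem]
  exact hY.coeFn_toLp

theorem add_smul_rankOneCLM_ae_eq_greenSolution (hS : E.IsL2FundamentalSystem z φ φ₁ χ χ₁)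
    {R : E.L2w E.I →L[ℂ] E.L2w E.I}
    (hR : ∀ F, R F =ᵐ[E.wMeasure E.I] E.greenSolution φ χ F) (κ : ℂ) (F : E.L2w E.I) :
    (R + κ • rankOneCLM hS.memLp_left hS.memLp_left) F =ᵐ[E.wMeasure E.I]
      E.greenSolution φ (fun t => χ t + κ * φ t) F := by
  have hF := Lp.memLp F
  set T := rankOneCLM hS.memLp_left hS.memLp_left
  rw [add_apply, smul_apply]
  filter_upwards [Lp.coeFn_add (R F) (κ • T F), Lp.coeFn_smul κ (T F), hR F,
    coeFn_rankOneCLM hS.memLp_left hS.memLp_left F] with x hadd hsmul hRx hTx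
  rw [hadd, Pi.add_apply, hsmul, Pi.smul_apply, hRx, hTx, smul_eq_mul,
    greenSolution_add_const_mul (hS.memLp_left.integrable_mul hF)
      (hS.memLp_right.integrable_mul hF), mul_assoc]

theorem tendsto_norm_truncation_sub (hS : E.IsL2FundamentalSystem z φ φ₁ χ χ₁)
    {R : E.L2w E.I →L[ℂ] E.L2w E.I}
    (hR : ∀ F, R F =ᵐ[E.wMeasure E.I] E.greenSolution φ χ F) {S : ℝ → E.L2w E.I →L[ℂ] E.L2w E.I}
    (hS0 : Tendsto S E.atEnd (𝓝 0)) :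
    Tendsto (fun c => ‖(R + S c) ∘L E.truncation c - R‖) E.atEnd (𝓝 0) := by
  have hA := hS.memLp_norm_add_norm
  have tail_le : ∀ c, ‖R ∘L indicatorCLM ℂ ℂ 2 (E.wMeasure E.I) (measurableSet_Iic (a := c)).compl‖
      ≤ ‖hA.toLp _‖ * √(∫ t in Ioi c, (‖φ t‖ + ‖χ t‖) ^ 2 ∂E.wMeasure E.I) := by
    intro c
    rw [← compl_Iic]
    refine norm_comp_indicatorCLM_le hA (fun t => by positivity) (fun F => ?_) _
    filter_upwards [hR F] with x hx
    rw [hx]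
    exact hS.norm_greenSolution_le (Lp.memLp F) x
  have hlim := hS0.norm.add ((tendsto_setIntegral_Ioi hA.integrable_sq).sqrt.const_mul ‖hA.toLp _‖)
  rw [norm_zero, Real.sqrt_zero, mul_zero, add_zero] at hlim
  exact squeeze_zero (fun c => norm_nonneg _) (fun c =>
    (norm_add_comp_indicatorCLM_sub_le R (S c) measurableSet_Iic).trans
      (add_le_add_right (tail_le c) _)) hlim

end IsL2FundamentalSystem

end Resolvent

theorem IsFundamentalPair.bca {θ θ₁ φ φ₁ : ℂ → ℝ → ℂ} (h : E.IsFundamentalPair α θ θ₁ φ φ₁)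
    (z : ℂ) : E.BCa α (φ z) (φ₁ z) := by
  obtain ⟨-, -, hφ, hφ₁, -⟩ := h z
  rw [BCa, hφ, hφ₁]
  ring

theorem CaseII.isLimitCircle {η : ℝ} {K : ℂ} (h : E.CaseII η K) : E.IsLimitCircle := by
  obtain ⟨l, -, -, hl⟩ := h
  exact ⟨l, hl⟩

theorem CaseIII.isLimitCircle {η : ℝ} {K : ℂ} (h : E.CaseIII η K) : E.IsLimitCircle := by
  obtain ⟨l, -, hl⟩ := h
  exact ⟨l, fun y u hy => (hl y u hy).1⟩

end SLExpr

theorem mainTheorem4_general (E : SLExpr) (hE : E.IsLimitCircle) {α : ℂ}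
    {θ θ₁ φ φ₁ : ℂ → ℝ → ℂ} (hfund : E.IsFundamentalPair α θ θ₁ φ φ₁)
    {l' : ℂ} {ψ ψ₁ : ℝ → ℂ} (hψ : E.IsSolution l' ψ ψ₁)
    {z : ℂ} (hz : z ∉ graphSpectrum (E.graphM α ψ ψ₁)) {mc : ℝ → ℂ}
    (hmc : ∀ c, mc c = SLExpr.mTrunc (θ z) (θ₁ z) (φ z) (φ₁ z) ψ ψ₁ c) :
    ∃ (R : E.L2w E.I →L[ℂ] E.L2w E.I) (Rc : ℝ → E.L2w E.I →L[ℂ] E.L2w E.I),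
      IsResolventAt (E.graphM α ψ ψ₁) z R ∧
      (∀ᶠ c in E.atEnd, ∀ f : E.L2w E.I, Rc c f =ᵐ[E.wMeasure E.I] fun x =>
        ∫ t in E.a..c,
          SLExpr.green (φ z) (fun s => θ z s + mc c * φ z s) x t * f t * (E.w t : ℂ)) ∧
      (∀ᶠ c in E.atEnd,
        ∀ Sc : E.L2w (Set.Icc E.a c) →L[ℂ] E.L2w (Set.Icc E.a c),
          IsResolventAt (E.graphTrunc α ψ ψ₁ c) z Sc →
          ∀ (f : E.L2w E.I) (g : E.L2w (Set.Icc E.a c)), g =ᵐ[E.wMeasure (Set.Icc E.a c)] f →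
            Rc c f =ᵐ[E.wMeasure (Set.Icc E.a c)] Sc g) ∧
      Tendsto (fun c => ‖Rc c - R‖) E.atEnd (𝓝 0) := by
  obtain rfl := funext hmc
  obtain ⟨R, hR⟩ := not_not.1 hz
  have hS := hfund.isL2FundamentalSystem hE z
  have hbc := hfund.bca z
  obtain ⟨ω, m, hω0, hω, hm, hχ⟩ := hS.exists_tendsto_mTrunc hbc hψ hR
  set mc := SLExpr.mTrunc (θ z) (θ₁ z) (φ z) (φ₁ z) ψ ψ₁
  have R_ae_eq := (hS.add_const_mul m).resolvent_ae_eq_greenSolution hbc hR hω hχ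
  set T := rankOneCLM hS.memLp_left hS.memLp_left
  have Rc_ae_eq : ∀ c f, ((R + (mc c - m) • T) ∘L E.truncation c) f =ᵐ[E.wMeasure E.I]
      E.greenSolution (φ z) (fun t => θ z t + mc c * φ z t) (E.truncation c f) := by
    intro c f
    have combine : (fun t => θ z t + mc c * φ z t) =
        fun t => (θ z t + m * φ z t) + (mc c - m) * φ z t := by
      funext t
      ring
    rw [combine, ContinuousLinearMap.comp_apply]
    exact (hS.add_const_mul m).add_smul_rankOneCLM_ae_eq_greenSolution R_ae_eq (mc c - m)
      (E.truncation c f)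
  refine ⟨R, fun c => (R + (mc c - m) • T) ∘L E.truncation c, hR, ?_, ?_, ?_⟩
  · filter_upwards [SLExpr.eventually_mem_I] with c hc f
    refine (Rc_ae_eq c f).trans (.of_forall fun x => ?_)
    have hSc := hS.add_const_mul (mc c)
    have hf := Lp.memLp (E.truncation c f)
    exact (SLExpr.greenSolution_eq_integral_green (hSc.memLp_left.integrable_mul hf)
      (hSc.memLp_right.integrable_mul hf) x).trans (SLExpr.integral_mul_truncation hc _ f)
  · filter_upwards [SLExpr.eventually_mem_I, hω.eventually_ne hω0] with c hc hωc Sc hSc f g hgf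
    have Sc_ae_eq := (hS.add_const_mul (mc c)).truncatedResolvent_ae_eq_greenSolution hbc hc hSc
      (SLExpr.wronskian_add_mTrunc_mul hωc) hgf
    refine EventuallyEq.trans ?_ Sc_ae_eq.symm
    rw [← SLExpr.wMeasure_restrict_Iic hc]
    exact ae_restrict_of_ae (Rc_ae_eq c f)
  · refine (hS.add_const_mul m).tendsto_norm_truncation_sub R_ae_eq ?_
    simpa only [sub_self, zero_smul] using (hm.sub_const m).smul_const T

theorem mainTheorem4 (E : SLExpr) (α : ℂ) (η : ℝ) (K : ℂ) (hS : (η, K) ∈ E.S α)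
    (hcase : E.CaseII η K ∨ E.CaseIII η K)
    (θ θ₁ φ φ₁ : ℂ → ℝ → ℂ) (hfund : E.IsFundamentalPair α θ θ₁ φ φ₁)
    -- the boundary condition at `b`: `ψ = θ(·, l') + m' φ(·, l')`
    (l' : ℂ) (hl' : l' ∈ SLExpr.halfPlane η K) (m' : ℂ) (ψ ψ₁ : ℝ → ℂ)
    (hψ : ψ = fun x => θ l' x + m' * φ l' x) (hψ₁ : ψ₁ = fun x => θ₁ l' x + m' * φ₁ l' x)
    (bn : ℕ → ℝ) (hmono : Monotone bn) (hbn : ∀ n, E.a < bn n ∧ (bn n : EReal) < E.b)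
    (hlim : Tendsto (fun n => (bn n : EReal)) atTop (𝓝 E.b))
    (z : ℂ) (hz : z ∉ graphSpectrum (E.graphM α ψ ψ₁))
    (hzn : ∀ᶠ n in atTop, z ∉ graphSpectrum (E.graphTrunc α ψ ψ₁ (bn n)))
    (mn : ℕ → ℂ)
    (hmn : ∀ n, mn n = SLExpr.mTrunc (θ z) (θ₁ z) (φ z) (φ₁ z) ψ ψ₁ (bn n)) :
    ∃ (R : E.L2w E.I →L[ℂ] E.L2w E.I) (Rn : ℕ → E.L2w E.I →L[ℂ] E.L2w E.I),
      IsResolventAt (E.graphM α ψ ψ₁) z R ∧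
      -- `Rn n` is the integral operator with the Green's function as its kernel
      (∀ᶠ n in atTop, ∀ f : E.L2w E.I, Rn n f =ᵐ[E.wMeasure E.I] fun x =>
        ∫ t in E.a..bn n,
          SLExpr.green (φ z) (fun s => θ z s + mn n * φ z s) x t * f t * (E.w t : ℂ)) ∧
      -- `Rn n` extends the resolvent of the truncated operator
      (∀ᶠ n in atTop,
        ∀ Sn : E.L2w (Set.Icc E.a (bn n)) →L[ℂ] E.L2w (Set.Icc E.a (bn n)),
          IsResolventAt (E.graphTrunc α ψ ψ₁ (bn n)) z Sn →
          ∀ (f : E.L2w E.I) (g : E.L2w (Set.Icc E.a (bn n))),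
            g =ᵐ[E.wMeasure (Set.Icc E.a (bn n))] f →
            Rn n f =ᵐ[E.wMeasure (Set.Icc E.a (bn n))] Sn g) ∧
      Tendsto (fun n => ‖Rn n - R‖) atTop (𝓝 0) := by
  have hE : E.IsLimitCircle :=
    hcase.elim SLExpr.CaseII.isLimitCircle SLExpr.CaseIII.isLimitCircle
  have hψs : E.IsSolution l' ψ ψ₁ := by
    rw [hψ, hψ₁]
    exact (hfund l').1.add_const_mul (hfund l').2.1 m'
  have hend : Tendsto bn atTop E.atEnd := tendsto_comap_iff.2 <|
    tendsto_nhdsWithin_iff.2 ⟨hlim, .of_forall fun n => (hbn n).2⟩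
  obtain rfl := funext hmn
  obtain ⟨R, Rc, hR, hgreen, hext, hnorm⟩ := mainTheorem4_general E hE hfund hψs hz fun _ => rfl
  exact ⟨R, Rc ∘ bn, hR, hend.eventually hgreen, hend.eventually hext, hnorm.comp hend⟩
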